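/- Let $R$ be a commutative Noetherian ring with identity, let $\mathfrak a$ be an ideal of $R$, and let $L$, $M$, $N$ be finitely generated $R$-modules. For finitely generated $R$-modules $X,Y$ and $i\ge 0$ let $H^i_{\mathfrak a}(X,Y)=\varinjlim_n \operatorname{Ext}^i_R(X/\mathfrak a^nX,Y)$ be the $i$-th generalized local cohomology module, and let $$f_{\mathfrak a}(X,Y)=\inf\{i\ge 0 : H^i_{\mathfrak a}(X,Y)\text{ is not finitely generated}\},$$ with $\inf\emptyset=+\infty$. If $\operatorname{Supp}_R M\subseteq\operatorname{Supp}_R N$, then $f_{\mathfrak a}(M,L)\ge f_{\mathfrak a}(N,L)$. In particular, if $\operatorname{Supp}_R N=\operatorname{Supp}_R M$, then $f_{\mathfrak a}(M,L)=f_{\mathfrak a}(N,L)$. -/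

import Mathlib

open CategoryTheory

universe v u

noncomputable section

/-- The transition map `Ext^i(M/a^m M, L) → Ext^i(M/a^n M, L)` for `m ≤ n`, induced by the
canonical projection `M/a^n M → M/a^m M`. -/
def genLocalCohomologyMap {R : Type u} [CommRing R] [Small.{v} R] (a : Ideal R)
    (M L : Type v) [AddCommGroup M] [Module R M] [AddCommGroup L] [Module R L] (i : ℕ)
    (m n : ℕ) (h : m ≤ n) :
    Abelian.Ext (ModuleCat.of R (M ⧸ (a ^ m • ⊤ : Submodule R M))) (ModuleCat.of R L) i →ₗ[R]
      Abelian.Ext (ModuleCat.of R (M ⧸ (a ^ n • ⊤ : Submodule R M))) (ModuleCat.of R L) i :=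
  (Abelian.Ext.mk₀ (ModuleCat.ofHom (Submodule.factorPow a M h))).precompOfLinear R
    (ModuleCat.of R L) (zero_add i)

/-- The modules `Ext^i(M/a^n M, L)` form a directed system. -/
instance genLocalCohomologyMap_directedSystem {R : Type u} [CommRing R] [Small.{v} R]
    (a : Ideal R) (M L : Type v) [AddCommGroup M] [Module R M] [AddCommGroup L] [Module R L]
    (i : ℕ) :
    DirectedSystem
      (fun n : ℕ => Abelian.Ext (ModuleCat.of R (M ⧸ (a ^ n • ⊤ : Submodule R M)))
        (ModuleCat.of R L) i)
      (fun m n h => genLocalCohomologyMap a M L i m n h) where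
  map_self n x := by
    simp [genLocalCohomologyMap]
  map_map k m n hmk hkn x := by
    have : ModuleCat.ofHom (Submodule.factorPow a M (hmk.trans hkn)) =
        ModuleCat.ofHom (Submodule.factorPow a M hkn) ≫
          ModuleCat.ofHom (Submodule.factorPow a M hmk) := by
      ext x; simp
    simp [genLocalCohomologyMap, this]

/-- The `i`-th generalized local cohomology module
`H^i_a(M, L) = colim_n Ext^i_R(M/a^n M, L)`. -/
abbrev GenLocalCohomology {R : Type u} [CommRing R] [Small.{v} R] (a : Ideal R)
    (M L : Type v) [AddCommGroup M] [Module R M] [AddCommGroup L] [Module R L] (i : ℕ) :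
    Type v :=
  Module.DirectLimit
    (fun n : ℕ => Abelian.Ext (ModuleCat.of R (M ⧸ (a ^ n • ⊤ : Submodule R M)))
      (ModuleCat.of R L) i)
    (genLocalCohomologyMap a M L i)

/-- The finiteness dimension `f_a(M, L) = inf {i | H^i_a(M, L) is not finitely generated}`
of the pair `(M, L)` relative to `a`, with `inf ∅ = ∞`. -/
def finitenessDim {R : Type u} [CommRing R] [Small.{v} R] (a : Ideal R)
    (M L : Type v) [AddCommGroup M] [Module R M] [AddCommGroup L] [Module R L] : ℕ∞ :=
  sInf ((fun i : ℕ => (i : ℕ∞)) '' {i : ℕ | ¬ Module.Finite R (GenLocalCohomology a M L i)})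

end

/-!
Write `H^i(M) = H^i_a(M, L)`. It suffices to show that if `H^j(N)` is finitely generated for all
`j ≤ i` and `Supp M ⊆ Supp N`, then `H^i(M)` is finitely generated
(`GenLocalCohomology.finite_of_support_subset`).

A short exact sequence `0 → M' → M → M'' → 0` of finite modules gives short exact sequences
`0 → M' ⧸ (M' ∩ a ^ n M) → M ⧸ a ^ n M → M'' ⧸ a ^ n M'' → 0`, whose long exact sequences of `Ext`
pass to the colimit over `n`. By the Artin–Rees lemma the filtration of `M'` by `M' ∩ a ^ n M` is
cofinal with the `a`-adic one, so its colimit of `Ext` embeds into `H^i(M')`. Over a Noetherian ring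
this yields two closure properties:
* `GenLocalCohomology.finite_of_exact`: if `H^i(M')` and `H^i(M'')` are finite, so is `H^i(M)`;
* `GenLocalCohomology.finite_quotient_of_exact`: if `H^i(M)` and all `H^j(M')` with `j < i` are
  finite, so is `H^i(M'')`.

The claim is then proved by induction on `i`. Prime filtrations and the first property reduce it to
`M = R ⧸ p` with `p ∈ Supp N`, where Noetherian induction allows the claim to be assumed for all
larger primes. There is a nonzero map `φ : N → R ⧸ p` (`exists_ne_zero_linearMap_of_mem_support`).
Its image is a quotient of `N` by a kernel whose cohomology in degrees below `i` is finite by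
induction on `i`, so the second property applies to the image. The cokernel of `φ` is supported on
primes strictly containing `p`, and the first property finishes the proof.
-/

noncomputable section

open Abelian

/-! ### Colimits of `Ext` along an inverse system in the first variable -/

section Tower

universe w t c₁ c₂

variable (R : Type t) [CommRing R] {C : Type c₁} [Category.{c₂} C] [Abelian C] [Linear R C]
  [HasExt.{w} C]

/-- The transition map `Ext^i(X m, L) → Ext^i(X n, L)`, for `m ≤ n`, of the direct system obtained
by applying `Ext^i(-, L)` to a tower `⋯ ⟶ X 2 ⟶ X 1 ⟶ X 0`. -/
def extTowerMap (X : ℕᵒᵖ ⥤ C) (L : C) (i m n : ℕ) (h : m ≤ n) :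
    Ext (X.obj ⟨m⟩) L i →ₗ[R] Ext (X.obj ⟨n⟩) L i :=
  (Ext.mk₀ (X.map (homOfLE h).op)).precompOfLinear R L (zero_add i)

lemma extTowerMap_apply (X : ℕᵒᵖ ⥤ C) (L : C) (i m n : ℕ) (h : m ≤ n)
    (x : Ext (X.obj ⟨m⟩) L i) :
    extTowerMap R X L i m n h x = (Ext.mk₀ (X.map (homOfLE h).op)).comp x (zero_add i) := rfl

instance extTowerMap_directedSystem (X : ℕᵒᵖ ⥤ C) (L : C) (i : ℕ) :
    DirectedSystem (fun n : ℕ => Ext (X.obj ⟨n⟩) L i)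
      (fun m n h => extTowerMap R X L i m n h) where
  map_self n x := by
    simp [extTowerMap_apply]
  map_map k m n hmk hkn x := by
    have h : X.map (homOfLE (hmk.trans hkn)).op =
        X.map (homOfLE hkn).op ≫ X.map (homOfLE hmk).op := by
      rw [← X.map_comp]; rfl
    simp [extTowerMap_apply, h]

/-- The colimit `colim_n Ext^i(X n, L)` for a tower `⋯ ⟶ X 2 ⟶ X 1 ⟶ X 0`. -/
abbrev ExtTowerColimit (X : ℕᵒᵖ ⥤ C) (L : C) (i : ℕ) : Type w :=
  Module.DirectLimit (fun n : ℕ => Ext (X.obj ⟨n⟩) L i) (extTowerMap R X L i)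

/-- The map on `colim_n Ext^i(-, L)` induced by a morphism of towers. -/
def extTowerColimitMap {X Y : ℕᵒᵖ ⥤ C} (φ : X ⟶ Y) (L : C) (i : ℕ) :
    ExtTowerColimit R Y L i →ₗ[R] ExtTowerColimit R X L i :=
  Module.DirectLimit.map
    (fun n => (Ext.mk₀ (φ.app ⟨n⟩)).precompOfLinear R L (zero_add i)) (by
      intro m n h
      ext x
      simp only [LinearMap.comp_apply, extTowerMap_apply, Ext.bilinearCompOfLinear_apply_apply]
      simp)

lemma extTowerColimitMap_of {X Y : ℕᵒᵖ ⥤ C} (φ : X ⟶ Y) (L : C) (i n : ℕ)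
    (x : Ext (Y.obj ⟨n⟩) L i) :
    extTowerColimitMap R φ L i (Module.DirectLimit.of R ℕ _ (extTowerMap R Y L i) n x) =
      Module.DirectLimit.of R ℕ _ (extTowerMap R X L i) n
        ((Ext.mk₀ (φ.app ⟨n⟩)).comp x (zero_add i)) :=
  Module.DirectLimit.map_apply_of _ _ _

/-- If the transition maps of `Y` eventually factor through `φ : X ⟶ Y`, then `φ` induces an
injection on colimits of `Ext`. -/
lemma extTowerColimitMap_injective {X Y : ℕᵒᵖ ⥤ C} (φ : X ⟶ Y) (L : C) (i : ℕ)
    (hφ : ∀ n, ∃ (m : ℕ) (h : n ≤ m) (ψ : Y.obj ⟨m⟩ ⟶ X.obj ⟨n⟩),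
      ψ ≫ φ.app ⟨n⟩ = Y.map (homOfLE h).op) :
    Function.Injective (extTowerColimitMap R φ L i) := by
  rw [injective_iff_map_eq_zero]
  intro z hz
  obtain ⟨n, x, rfl⟩ := Module.DirectLimit.exists_of z
  rw [extTowerColimitMap_of] at hz
  obtain ⟨m, hnm, hm⟩ := Module.DirectLimit.of.zero_exact hz
  obtain ⟨k, hmk, ψ, hψ⟩ := hφ m
  rw [← Module.DirectLimit.of_f (hij := hnm), ← Module.DirectLimit.of_f (hij := hmk)]
  rw [extTowerMap_apply, Ext.mk₀_comp_mk₀_assoc, φ.naturality, ← Ext.mk₀_comp_mk₀_assoc] at hm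
  rw [extTowerMap_apply, ← hψ, ← Ext.mk₀_comp_mk₀_assoc, extTowerMap_apply, hm, Ext.comp_zero,
    map_zero]

variable {X Y Z : ℕᵒᵖ ⥤ C} {f : X ⟶ Y} {g : Y ⟶ Z} {w : f ≫ g = 0}

/-- A levelwise short exact sequence of towers `0 ⟶ X ⟶ Y ⟶ Z ⟶ 0` induces an exact sequence
`colim Ext^i(Z n, L) → colim Ext^i(Y n, L) → colim Ext^i(X n, L)`. -/
lemma extTowerColimitMap_exact (L : C) (i : ℕ)
    (hS : ∀ n, ((ShortComplex.mk f g w).map ((evaluation _ _).obj n)).ShortExact) :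
    Function.Exact (extTowerColimitMap R g L i) (extTowerColimitMap R f L i) := by
  refine fun z => ⟨fun hz => ?_, ?_⟩
  · obtain ⟨n, x, rfl⟩ := Module.DirectLimit.exists_of z
    rw [extTowerColimitMap_of] at hz
    obtain ⟨m, h, hm⟩ := Module.DirectLimit.of.zero_exact hz
    rw [extTowerMap_apply, Ext.mk₀_comp_mk₀_assoc, f.naturality, ← Ext.mk₀_comp_mk₀_assoc] at hm
    obtain ⟨y, hy⟩ := Ext.contravariant_sequence_exact₂ (hS ⟨m⟩) L _ hm
    refine ⟨Module.DirectLimit.of R ℕ _ _ m y, ?_⟩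
    refine (extTowerColimitMap_of R g L i m y).trans ((congrArg _ hy).trans ?_)
    rw [← extTowerMap_apply R, Module.DirectLimit.of_f]
  · rintro ⟨y, rfl⟩
    obtain ⟨n, x, rfl⟩ := Module.DirectLimit.exists_of y
    have h : f.app ⟨n⟩ ≫ g.app ⟨n⟩ = 0 := by rw [← NatTrans.comp_app, w]; rfl
    rw [extTowerColimitMap_of, extTowerColimitMap_of, Ext.mk₀_comp_mk₀_assoc, h]
    simp

lemma extTowerColimitMap_injective_of_epi (L : C) (g : Y ⟶ Z) (hg : ∀ n, Epi (g.app n)) :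
    Function.Injective (extTowerColimitMap R g L 0) := by
  rw [injective_iff_map_eq_zero]
  intro z hz
  obtain ⟨n, x, rfl⟩ := Module.DirectLimit.exists_of z
  rw [extTowerColimitMap_of] at hz
  obtain ⟨m, h, hm⟩ := Module.DirectLimit.of.zero_exact hz
  rw [extTowerMap_apply, Ext.mk₀_comp_mk₀_assoc, g.naturality, ← Ext.mk₀_comp_mk₀_assoc] at hm
  have := hg ⟨m⟩
  rw [← Module.DirectLimit.of_f (hij := h), extTowerMap_apply,
    Ext.precomp_mk₀_injective_of_epi L (g.app ⟨m⟩) (hm.trans (map_zero _).symm), map_zero]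

/-- The connecting map `colim_n Ext^i(X n, L) → colim_n Ext^(i+1)(Z n, L)` of a levelwise short
exact sequence of towers `0 ⟶ X ⟶ Y ⟶ Z ⟶ 0`. -/
def extTowerColimitDelta (L : C) (i : ℕ)
    (hS : ∀ n, ((ShortComplex.mk f g w).map ((evaluation _ _).obj n)).ShortExact) :
    ExtTowerColimit R X L i →ₗ[R] ExtTowerColimit R Z L (i + 1) :=
  Module.DirectLimit.map
    (fun n => (hS ⟨n⟩).extClass.precompOfLinear R L (add_comm 1 i)) (by
      intro m n h
      ext x
      -- Compatibility with the transition maps is naturality of the extension class, up to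
      -- associativity of the composition of `Ext`.
      have key := ShortComplex.ShortExact.extClass_naturality (hS ⟨n⟩) (hS ⟨m⟩)
        ((ShortComplex.mk f g w).mapNatTrans ((evaluation _ C).map (homOfLE h).op))
      have h1 := Ext.comp_assoc (hS ⟨n⟩).extClass (Ext.mk₀ (X.map (homOfLE h).op)) x
        (add_zero 1) (zero_add i) (add_comm 1 i)
      have h2 := Ext.comp_assoc (Ext.mk₀ (Z.map (homOfLE h).op)) (hS ⟨m⟩).extClass x
        (zero_add 1) (add_comm 1 i) (a := i + 1) (by omega)
      exact h1.symm.trans ((congrArg (fun e => e.comp x (add_comm 1 i)) key).trans h2))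

/-- Exactness of `colim Ext^i(X n, L) → colim Ext^(i+1)(Z n, L) → colim Ext^(i+1)(Y n, L)`: the
kernel of the second map lies in the range of the connecting map. -/
lemma exists_extTowerColimitDelta_eq (L : C) (i : ℕ)
    (hS : ∀ n, ((ShortComplex.mk f g w).map ((evaluation _ _).obj n)).ShortExact)
    (z : ExtTowerColimit R Z L (i + 1)) (hz : extTowerColimitMap R g L (i + 1) z = 0) :
    ∃ y, extTowerColimitDelta R L i hS y = z := by
  obtain ⟨n, x, rfl⟩ := Module.DirectLimit.exists_of z
  rw [extTowerColimitMap_of] at hz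
  obtain ⟨m, h, hm⟩ := Module.DirectLimit.of.zero_exact hz
  rw [extTowerMap_apply, Ext.mk₀_comp_mk₀_assoc, g.naturality, ← Ext.mk₀_comp_mk₀_assoc] at hm
  obtain ⟨y, hy⟩ := Ext.contravariant_sequence_exact₃ (hS ⟨m⟩) L _ hm (add_comm 1 i)
  refine ⟨Module.DirectLimit.of R ℕ _ _ m y, ?_⟩
  refine (Module.DirectLimit.map_apply_of _ _ _).trans ((congrArg _ hy).trans ?_)
  rw [← extTowerMap_apply R, Module.DirectLimit.of_f]

end Tower

/-! ### Towers of quotients and Artin–Rees -/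

section QuotientTower

variable {R : Type u} [CommRing R] {M : Type v} [AddCommGroup M] [Module R M]
  {M' : Type v} [AddCommGroup M'] [Module R M'] {M'' : Type v} [AddCommGroup M''] [Module R M'']

/-- The tower `⋯ ⟶ M ⧸ F 1 ⟶ M ⧸ F 0` attached to a decreasing filtration `F` of `M`. -/
def quotientTower (F : ℕ → Submodule R M) (hF : Antitone F) : ℕᵒᵖ ⥤ ModuleCat.{v} R where
  obj n := ModuleCat.of R (M ⧸ F n.unop)
  map h := ModuleCat.ofHom (Submodule.factor (hF (leOfHom h.unop)))
  map_id n := by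
    ext x
    rfl
  map_comp h k := by
    ext x
    rfl

/-- The morphism of towers induced by a linear map that respects the filtrations. -/
def quotientTowerMap {F : ℕ → Submodule R M} {G : ℕ → Submodule R M'} (hF : Antitone F)
    (hG : Antitone G) (f : M →ₗ[R] M') (hf : ∀ n, F n ≤ (G n).comap f) :
    quotientTower F hF ⟶ quotientTower G hG where
  app n := ModuleCat.ofHom ((F n.unop).mapQ (G n.unop) f (hf n.unop))
  naturality m n h := by
    ext x
    obtain ⟨x, rfl⟩ := Submodule.Quotient.mk_surjective _ x
    rfl

lemma antitone_pow_smul_top (a : Ideal R) : Antitone fun n : ℕ => (a ^ n • ⊤ : Submodule R M) :=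
  fun _ _ h => Submodule.smul_mono_left (Ideal.pow_le_pow_right h)

variable (M) in
/-- The tower with terms `M ⧸ a ^ n M`, whose `Ext`-colimit is `H^i_a(M, L)`. -/
abbrev adicTower (a : Ideal R) : ℕᵒᵖ ⥤ ModuleCat.{v} R :=
  quotientTower (fun n : ℕ => (a ^ n • ⊤ : Submodule R M)) (antitone_pow_smul_top a)

lemma pow_smul_top_le_comap (a : Ideal R) (f : M →ₗ[R] M') (n : ℕ) :
    (a ^ n • ⊤ : Submodule R M) ≤ (a ^ n • ⊤ : Submodule R M').comap f := by
  rw [← Submodule.map_le_iff_le_comap, Submodule.map_smul'']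
  exact smul_mono_right _ le_top

/-- The tower with terms `M ⧸ f⁻¹(a ^ n M')`, for a linear map `f : M → M'`. For injective `f` it is
the tower of the filtration induced on `M` by the `a`-adic filtration of `M'`. -/
abbrev inducedTower (a : Ideal R) (f : M →ₗ[R] M') : ℕᵒᵖ ⥤ ModuleCat.{v} R :=
  quotientTower (fun n : ℕ => (a ^ n • ⊤ : Submodule R M').comap f)
    fun _ _ h => Submodule.comap_mono (antitone_pow_smul_top a h)

/-- By the Artin–Rees lemma the `a`-adic filtration on a submodule is cofinal with the induced
one. -/
lemma exists_comap_pow_smul_top_le [IsNoetherianRing R] [Module.Finite R M'] (a : Ideal R)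
    (f : M →ₗ[R] M') (hf : Function.Injective f) (n : ℕ) :
    ∃ m, n ≤ m ∧ (a ^ m • ⊤ : Submodule R M').comap f ≤ (a ^ n • ⊤ : Submodule R M) := by
  obtain ⟨k, hk⟩ := Ideal.exists_pow_inf_eq_pow_smul a (LinearMap.range f)
  refine ⟨n + k, Nat.le_add_right n k, ?_⟩
  rw [← Submodule.map_le_map_iff_of_injective hf, Submodule.map_comap_eq, inf_comm,
    hk _ (Nat.le_add_left k n), Submodule.map_smul'', Submodule.map_top, Nat.add_sub_cancel]
  exact smul_mono_right _ inf_le_right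

lemma quotientTowerMap_comp_eq_zero (a : Ideal R) {f : M' →ₗ[R] M} {g : M →ₗ[R] M''}
    (hfg : Function.Exact f g) :
    (quotientTowerMap _ _ f fun _ => le_rfl : inducedTower a f ⟶ adicTower M a) ≫
      (quotientTowerMap _ _ g (pow_smul_top_le_comap a g) :
        adicTower M a ⟶ adicTower M'' a) = 0 := by
  ext n x
  obtain ⟨x, rfl⟩ := Submodule.Quotient.mk_surjective _ x
  exact congrArg (Submodule.Quotient.mk (p := a ^ n.unop • ⊤)) (hfg.apply_apply_eq_zero x)

/-- A short exact sequence `0 → M' → M → M'' → 0` induces short exact sequences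
`0 → M' ⧸ f⁻¹(a ^ n M) → M ⧸ a ^ n M → M'' ⧸ a ^ n M'' → 0`. -/
lemma quotientTowerMap_shortExact (a : Ideal R) {f : M' →ₗ[R] M} {g : M →ₗ[R] M''}
    (hg : Function.Surjective g) (hfg : Function.Exact f g) (n : ℕᵒᵖ) :
    ((ShortComplex.mk _ _ (quotientTowerMap_comp_eq_zero a hfg)).map
      ((evaluation _ _).obj n)).ShortExact := by
  refine ModuleCat.shortComplex_shortExact _ (fun x => ⟨fun hx => ?_, ?_⟩) ?_ ?_
  · obtain ⟨x, rfl⟩ := Submodule.Quotient.mk_surjective _ x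
    have hx' : g x ∈ (a ^ n.unop • ⊤ : Submodule R M'') := (Submodule.Quotient.mk_eq_zero _).mp hx
    rw [← LinearMap.range_eq_top.mpr hg, ← Submodule.map_top, ← Submodule.map_smul''] at hx'
    obtain ⟨y, hy, hyx⟩ := hx'
    obtain ⟨z, hz⟩ := (hfg (x - y)).mp (by rw [map_sub, hyx, sub_self])
    refine ⟨Submodule.Quotient.mk z, (Submodule.Quotient.eq _).mpr ?_⟩
    rw [hz, sub_sub_cancel_left]
    exact neg_mem hy
  · rintro ⟨y, rfl⟩
    obtain ⟨y, rfl⟩ := Submodule.Quotient.mk_surjective _ y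
    exact congrArg (Submodule.Quotient.mk (p := a ^ n.unop • ⊤)) (hfg.apply_apply_eq_zero y)
  · refine (injective_iff_map_eq_zero _).mpr fun x hx => ?_
    obtain ⟨x, rfl⟩ := Submodule.Quotient.mk_surjective _ x
    exact (Submodule.Quotient.mk_eq_zero _).mpr
      (show f x ∈ _ from (Submodule.Quotient.mk_eq_zero _).mp hx)
  · intro x
    obtain ⟨x, rfl⟩ := Submodule.Quotient.mk_surjective _ x
    obtain ⟨x, rfl⟩ := hg x
    exact ⟨Submodule.Quotient.mk x, rfl⟩

/-- For a submodule `M'` of a finite module, the colimit of `Ext` along the tower of the induced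
filtration embeds into `H^i_a(M', L)`, so it is finite when the latter is. -/
lemma finite_extTowerColimit_inducedTower [IsNoetherianRing R] [Small.{v} R] (a : Ideal R)
    (L : Type v) [AddCommGroup L] [Module R L] [Module.Finite R M] {f : M' →ₗ[R] M}
    (hf : Function.Injective f) (i : ℕ) (hM' : Module.Finite R (GenLocalCohomology a M' L i)) :
    Module.Finite R (ExtTowerColimit R (inducedTower a f) (ModuleCat.of R L) i) := by
  have : Module.Finite R (ExtTowerColimit R (adicTower M' a) (ModuleCat.of R L) i) := hM'
  let φ : adicTower M' a ⟶ inducedTower a f :=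
    quotientTowerMap _ _ LinearMap.id (pow_smul_top_le_comap a f)
  refine Module.Finite.of_injective _
    (extTowerColimitMap_injective R φ (ModuleCat.of R L) i fun n => ?_)
  obtain ⟨m, hnm, hm⟩ := exists_comap_pow_smul_top_le a f hf n
  refine ⟨m, hnm, ModuleCat.ofHom (Submodule.factor hm), ?_⟩
  ext x
  obtain ⟨x, rfl⟩ := Submodule.Quotient.mk_surjective _ x
  rfl

lemma GenLocalCohomology.finite_of_exact [IsNoetherianRing R] [Small.{v} R] (a : Ideal R)
    (L : Type v) [AddCommGroup L] [Module R L] [Module.Finite R M]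
    {f : M' →ₗ[R] M} {g : M →ₗ[R] M''} (hf : Function.Injective f) (hg : Function.Surjective g)
    (hfg : Function.Exact f g) (i : ℕ) (hM' : Module.Finite R (GenLocalCohomology a M' L i))
    (hM'' : Module.Finite R (GenLocalCohomology a M'' L i)) :
    Module.Finite R (GenLocalCohomology a M L i) := by
  have := finite_extTowerColimit_inducedTower a L hf i hM'
  have : Module.Finite R (ExtTowerColimit R (adicTower M'' a) (ModuleCat.of R L) i) := hM''
  have h := extTowerColimitMap_exact R (ModuleCat.of R L) i
    (quotientTowerMap_shortExact a hg hfg)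
  have := isNoetherian_of_range_eq_ker _ _ h.linearMap_ker_eq.symm
  exact inferInstanceAs (Module.Finite R (ExtTowerColimit R (adicTower M a) (ModuleCat.of R L) i))

/-- The exact sequence `H^(i-1)_a(M', L) → H^i_a(M'', L) → H^i_a(M, L)` transfers finiteness to
its middle term; for `i = 0` the second map is injective. -/
lemma GenLocalCohomology.finite_quotient_of_exact [IsNoetherianRing R] [Small.{v} R]
    (a : Ideal R) (L : Type v) [AddCommGroup L] [Module R L] [Module.Finite R M]
    {f : M' →ₗ[R] M} {g : M →ₗ[R] M''} (hf : Function.Injective f) (hg : Function.Surjective g)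
    (hfg : Function.Exact f g) (i : ℕ)
    (hM' : ∀ j < i, Module.Finite R (GenLocalCohomology a M' L j))
    (hM : Module.Finite R (GenLocalCohomology a M L i)) :
    Module.Finite R (GenLocalCohomology a M'' L i) := by
  have : Module.Finite R (ExtTowerColimit R (adicTower M a) (ModuleCat.of R L) i) := hM
  have hS := quotientTowerMap_shortExact a hg hfg
  let γ : adicTower M a ⟶ adicTower M'' a := quotientTowerMap _ _ g (pow_smul_top_le_comap a g)
  change Module.Finite R (ExtTowerColimit R (adicTower M'' a) (ModuleCat.of R L) i)
  cases i with
  | zero =>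
    exact Module.Finite.of_injective _ (extTowerColimitMap_injective_of_epi R (ModuleCat.of R L) γ
      fun n => (hS n).epi_g)
  | succ i =>
    have := finite_extTowerColimit_inducedTower a L hf i (hM' i i.lt_succ_self)
    let δ := extTowerColimitDelta R (ModuleCat.of R L) i hS
    have : Module.Finite R (LinearMap.ker (extTowerColimitMap R γ (ModuleCat.of R L) (i + 1))) := by
      have hle : LinearMap.ker (extTowerColimitMap R γ (ModuleCat.of R L) (i + 1)) ≤
          LinearMap.range δ :=
        fun z hz => exists_extTowerColimitDelta_eq R (ModuleCat.of R L) i hS z hz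
      exact Module.Finite.of_injective _ (Submodule.inclusion_injective hle)
    have := isNoetherian_of_range_eq_ker
      (LinearMap.ker (extTowerColimitMap R γ (ModuleCat.of R L) (i + 1))).subtype
      (extTowerColimitMap R γ (ModuleCat.of R L) (i + 1)) (Submodule.range_subtype _)
    infer_instance

end QuotientTower

lemma GenLocalCohomology.finite_of_subsingleton {R : Type u} [CommRing R] [Small.{v} R]
    (a : Ideal R) (M L : Type v) [AddCommGroup M] [Module R M] [Subsingleton M] [AddCommGroup L]
    [Module R L] (i : ℕ) :
    Module.Finite R (GenLocalCohomology a M L i) := by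
  have (n : ℕ) : Subsingleton (Ext (ModuleCat.of R (M ⧸ (a ^ n • ⊤ : Submodule R M)))
      (ModuleCat.of R L) i) := by
    have h : 𝟙 (ModuleCat.of R (M ⧸ (a ^ n • ⊤ : Submodule R M))) = 0 :=
      (ModuleCat.isZero_of_subsingleton _).eq_of_src _ _
    refine subsingleton_of_forall_eq 0 fun x => ?_
    rw [← Ext.mk₀_id_comp x, h, Ext.mk₀_zero, Ext.zero_comp]
  have : Subsingleton (GenLocalCohomology a M L i) := by
    refine subsingleton_of_forall_eq 0 fun x => ?_
    obtain ⟨n, x, rfl⟩ := Module.DirectLimit.exists_of x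
    rw [Subsingleton.elim x 0, map_zero]
  infer_instance

/-! ### Supports and dévissage -/

/-- If `p ∈ Supp N`, then there is a nonzero map `N → R ⧸ p`. The target is replaced by an
isomorphic copy `M`, which may live in a different universe. -/
lemma exists_ne_zero_linearMap_of_mem_support {R : Type u} [CommRing R] [IsNoetherianRing R]
    {M : Type v} [AddCommGroup M] [Module R M] {N : Type v} [AddCommGroup N] [Module R N]
    [Module.Finite R N] (p : PrimeSpectrum R) (e : M ≃ₗ[R] R ⧸ p.asIdeal)
    (hp : p ∈ Module.support R N) : ∃ φ : N →ₗ[R] M, φ ≠ 0 := by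
  -- Among the submodules with `p` in the support of the quotient, take a maximal one, `K`. Every
  -- proper quotient of `N ⧸ K` then vanishes at `p`.
  obtain ⟨K, hK, hmax⟩ := wellFounded_gt.has_min
    {K : Submodule R N | p ∈ Module.support R (N ⧸ K)}
    ⟨⊥, by rwa [Set.mem_ofPred_eq, (Submodule.quotEquivOfEqBot ⊥ rfl).support_eq]⟩
  have hquot (W : Submodule R (N ⧸ K)) (hW : p ∈ Module.support R ((N ⧸ K) ⧸ W)) : W = ⊥ := by
    by_contra hne
    refine hmax (W.comap K.mkQ) ?_ (lt_of_le_of_ne ?_ ?_)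
    · refine Module.support_subset_of_surjective ((W.comap K.mkQ).mapQ W K.mkQ le_rfl) ?_ hW
      intro y
      obtain ⟨y, rfl⟩ := W.mkQ_surjective y
      obtain ⟨n, rfl⟩ := K.mkQ_surjective y
      exact ⟨Submodule.Quotient.mk n, rfl⟩
    · exact K.le_comap_mkQ W
    · intro h
      apply hne
      rw [← Submodule.map_comap_eq_of_surjective K.mkQ_surjective W, ← h, Submodule.mkQ_map_self]
  have hp0 : (p.asIdeal • ⊤ : Submodule R (N ⧸ K)) = ⊥ :=
    hquot _ (by
      rw [Module.support_quotient]
      exact ⟨hK, (PrimeSpectrum.mem_zeroLocus _ _).mpr le_rfl⟩)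
  obtain ⟨x, hx⟩ := Module.mem_support_iff'.mp hK
  have hx0 : x ≠ 0 := by simpa using hx 1 p.isPrime.one_notMem
  have hs := mt (hquot (R ∙ x)) (by simpa using hx0)
  rw [Module.mem_support_iff_of_finite, SetLike.not_le_iff_exists] at hs
  obtain ⟨s, hs, hsp⟩ := hs
  -- `x` spans a copy of `R ⧸ p`, and multiplication by `s` maps `N ⧸ K` into it without killing
  -- `x`.
  let h : (R ⧸ p.asIdeal) →ₗ[R] N ⧸ K := p.asIdeal.liftQ (LinearMap.toSpanSingleton R _ x)
    fun r hr => by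
      have : r • x ∈ (p.asIdeal • ⊤ : Submodule R (N ⧸ K)) :=
        Submodule.smul_mem_smul hr trivial
      simpa [hp0] using this
  have hinj : Function.Injective h := by
    rw [← LinearMap.ker_eq_bot]
    refine Submodule.ker_liftQ_eq_bot _ _ _ fun r hr => ?_
    by_contra hrp
    exact hx r hrp (by simpa using hr)
  have hrange (y : N ⧸ K) : s • y ∈ LinearMap.range h := by
    have hy : s • y ∈ R ∙ x := by
      rw [← Submodule.Quotient.mk_eq_zero, Submodule.Quotient.mk_smul]
      exact Module.mem_annihilator.mp hs _
    obtain ⟨r, hr⟩ := Submodule.mem_span_singleton.mp hy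
    exact ⟨Submodule.Quotient.mk r, hr⟩
  refine ⟨e.symm.toLinearMap ∘ₗ (LinearEquiv.ofInjective h hinj).symm.toLinearMap ∘ₗ
    (LinearMap.lsmul R (N ⧸ K) s).codRestrict _ hrange ∘ₗ K.mkQ, fun h0 => ?_⟩
  obtain ⟨n, rfl⟩ := K.mkQ_surjective x
  have h1 := LinearMap.congr_fun h0 n
  simp only [LinearMap.comp_apply, LinearEquiv.coe_coe, LinearMap.zero_apply,
    LinearEquiv.map_eq_zero_iff] at h1
  exact hx s hsp (congrArg Subtype.val h1)

/-- A property of finite modules that holds for zero modules and is closed under extensions holds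
for all modules supported in `S` once it holds for `A ⧸ p` with `p ∈ S`. -/
lemma Module.of_forall_quotient_prime {A : Type u} [CommRing A] [IsNoetherianRing A]
    {P : (X : Type v) → [AddCommGroup X] → [Module A X] → [Module.Finite A X] → Prop}
    (subsingleton : ∀ (X : Type v) [AddCommGroup X] [Module A X] [Module.Finite A X]
      [Subsingleton X], P X)
    (ext : ∀ (X Y Z : Type v) [AddCommGroup X] [Module A X] [Module.Finite A X]
      [AddCommGroup Y] [Module A Y] [Module.Finite A Y]
      [AddCommGroup Z] [Module A Z] [Module.Finite A Z] (f : X →ₗ[A] Y) (g : Y →ₗ[A] Z),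
      Function.Injective f → Function.Surjective g → Function.Exact f g → P X → P Z → P Y)
    (S : Set (PrimeSpectrum A))
    (prime : ∀ (X : Type v) [AddCommGroup X] [Module A X] [Module.Finite A X],
      ∀ p ∈ S, (X ≃ₗ[A] A ⧸ p.asIdeal) → P X)
    (X : Type v) [AddCommGroup X] [Module A X] [Module.Finite A X]
    (hX : Module.support A X ⊆ S) : P X := by
  revert hX
  induction ‹Module.Finite A X› using
    IsNoetherianRing.induction_on_isQuotientEquivQuotientPrime A with
  | subsingleton X => exact fun _ => subsingleton X
  | quotient X p e =>
    refine fun hX => prime X p (hX ?_) e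
    rw [e.support_eq, Module.mem_support_iff_of_finite, Ideal.annihilator_quotient]
  | exact X Y Z f g hf hg hfg hX hZ =>
    intro hY
    rw [Module.support_of_exact hfg hf hg, Set.union_subset_iff] at hY
    exact ext X Y Z f g hf hg hfg (hX hY.1) (hZ hY.2)

/-! ### Finiteness of generalized local cohomology -/

/-- If `H^j_a(N, L)` is finite for all `j ≤ i` and `Supp M ⊆ Supp N`, then `H^i_a(M, L)` is
finite. The proof is by induction on `i`, dévissage to `R ⧸ p` with `p ∈ Supp N`, and Noetherian
induction on `p`. -/
theorem GenLocalCohomology.finite_of_support_subset {R : Type u} [CommRing R]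
    [IsNoetherianRing R] [Small.{v} R] (a : Ideal R)
    (L N : Type v) [AddCommGroup L] [Module R L]
    [AddCommGroup N] [Module R N] [Module.Finite R N] (i : ℕ)
    (hN : ∀ j ≤ i, Module.Finite R (GenLocalCohomology a N L j))
    (M : Type v) [AddCommGroup M] [Module R M] [Module.Finite R M]
    (hM : Module.support R M ⊆ Module.support R N) :
    Module.Finite R (GenLocalCohomology a M L i) := by
  induction i using Nat.strong_induction_on generalizing M with
  | _ i ih =>
  -- In degree `i`, finiteness for all modules supported in `S` follows from the case of `R ⧸ p`
  -- with `p ∈ S`.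
  have devissage (S : Set (PrimeSpectrum R)) (hS : ∀ (X : Type v) [AddCommGroup X] [Module R X]
      [Module.Finite R X], ∀ p ∈ S, (X ≃ₗ[R] R ⧸ p.asIdeal) →
        Module.Finite R (GenLocalCohomology a X L i))
      (X : Type v) [AddCommGroup X] [Module R X] [Module.Finite R X]
      (hX : Module.support R X ⊆ S) : Module.Finite R (GenLocalCohomology a X L i) :=
    Module.of_forall_quotient_prime
      (P := fun X _ _ _ => Module.Finite R (GenLocalCohomology a X L i))
      (fun X _ _ _ _ => finite_of_subsingleton a X L i)
      (fun X Y Z _ _ _ _ _ _ _ _ _ f g hf hg hfg => finite_of_exact a L hf hg hfg i)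
      S hS X hX
  refine devissage (Module.support R N) (fun X _ _ _ p hp e => ?_) M hM
  have : WellFoundedGT (PrimeSpectrum R) :=
    StrictMono.wellFoundedGT (f := PrimeSpectrum.asIdeal) fun _ _ h => h
  induction p using WellFoundedGT.induction generalizing X with
  | _ p ihp =>
  obtain ⟨φ, hφ⟩ := exists_ne_zero_linearMap_of_mem_support p e hp
  have hann : Module.support R X = PrimeSpectrum.zeroLocus p.asIdeal := by
    rw [e.support_eq, Module.support_eq_zeroLocus, Ideal.annihilator_quotient]
  -- The range of `φ` is a quotient of `N`, and the kernel contributes only in degrees below `i`.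
  have hrange : Module.Finite R (GenLocalCohomology a (LinearMap.range φ) L i) := by
    refine finite_quotient_of_exact a L (LinearMap.ker φ).injective_subtype
      φ.surjective_rangeRestrict ?_ i (fun j hj => ?_) (hN i le_rfl)
    · rw [LinearMap.exact_iff, Submodule.range_subtype, LinearMap.ker_rangeRestrict]
    · exact ih j hj (fun k hk => hN k (hk.trans hj.le)) _
        (Module.support_subset_of_injective _ (LinearMap.ker φ).injective_subtype)
  refine finite_of_exact a L (LinearMap.range φ).injective_subtype
    (LinearMap.range φ).mkQ_surjective ?_ i hrange ?_
  · rw [LinearMap.exact_iff, Submodule.range_subtype, Submodule.ker_mkQ]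
  -- The cokernel of `φ` is supported on primes strictly above `p`: if `φ n` is the class of `r`
  -- in `R ⧸ p`, then `r ∉ p` annihilates it.
  · refine devissage {q | p < q} (fun Y _ _ _ q hq e' => ihp q hq Y _ _ inferInstance
      (Module.mem_support_mono (le_of_lt hq) hp) e') _ fun q hq => ?_
    have hpq : p ≤ q := by
      have := Module.support_subset_of_surjective _ (LinearMap.range φ).mkQ_surjective hq
      rwa [hann] at this
    refine lt_of_le_of_ne hpq ?_
    rintro rfl
    obtain ⟨n, hn⟩ : ∃ n, φ n ≠ 0 := by
      by_contra! h0
      exact hφ (LinearMap.ext h0)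
    obtain ⟨r, hr⟩ := Ideal.Quotient.mk_surjective (e (φ n))
    have hrp : r ∉ p.asIdeal := fun hrp =>
      hn (e.map_eq_zero_iff.mp (hr ▸ Ideal.Quotient.eq_zero_iff_mem.mpr hrp))
    refine Module.notMem_support_iff'.mpr (fun y => ⟨r, hrp, ?_⟩) hq
    obtain ⟨x, rfl⟩ := (LinearMap.range φ).mkQ_surjective y
    obtain ⟨t, ht⟩ := Ideal.Quotient.mk_surjective (e x)
    rw [← map_smul, ← LinearMap.mem_ker, Submodule.ker_mkQ]
    refine ⟨t • n, e.injective ?_⟩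
    rw [map_smul, map_smul, map_smul, ← hr, ← ht, Algebra.smul_def, Algebra.smul_def,
      Ideal.Quotient.algebraMap_eq, mul_comm]

theorem finitenessDim_mono {R : Type u} [CommRing R] [IsNoetherianRing R] [Small.{v} R]
    (a : Ideal R)
    (L M N : Type v) [AddCommGroup L] [Module R L]
    [AddCommGroup M] [Module R M] [Module.Finite R M]
    [AddCommGroup N] [Module R N] [Module.Finite R N]
    (h : Module.support R M ⊆ Module.support R N) : finitenessDim a N L ≤ finitenessDim a M L := by
  refine le_sInf ?_
  rintro _ ⟨i, hi, rfl⟩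
  by_contra hlt
  refine hi (GenLocalCohomology.finite_of_support_subset a L N i (fun j hj => ?_) M h)
  by_contra hj'
  exact hlt ((sInf_le (Set.mem_image_of_mem _ hj')).trans (Nat.cast_le.mpr hj))

end

theorem theorem2p1 {R : Type u} [CommRing R] [IsNoetherianRing R] [Small.{v} R] (a : Ideal R)
    (L M N : Type v) [AddCommGroup L] [Module R L] [Module.Finite R L]
    [AddCommGroup M] [Module R M] [Module.Finite R M]
    [AddCommGroup N] [Module R N] [Module.Finite R N] :
    (Module.support R M ⊆ Module.support R N → finitenessDim a N L ≤ finitenessDim a M L) ∧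
    (Module.support R N = Module.support R M → finitenessDim a M L = finitenessDim a N L) :=
  ⟨finitenessDim_mono a L M N, fun h =>
    le_antisymm (finitenessDim_mono a L N M h.le) (finitenessDim_mono a L M N h.ge)⟩
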